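/- Let $K$ be a field, $n\ge 0$ an integer, and $R=K[x_1,\dots,x_n,y_1,\dots,y_n,z_1,\dots,z_n]$. Let \[ M_{\mathrm{Diag}(n)}=\langle x_iy_jz_k:\ 1\le i<j<k\le n\rangle\subset R . \] Order the monomials $x_iy_jz_k$ $(1\le i<j<k\le n)$ lexicographically: $x_{i'}y_{j'}z_{k'}$ precedes $x_iy_jz_k$ if $i'<i$, or $i'=i$ and $j'<j$, or $i'=i$, $j'=j$ and $k'<k$. Then these monomials are the minimal monomial generators of $M_{\mathrm{Diag}(n)}$, and the ideal has linear quotients with respect to this order: for each generator $m$, the colon ideal $\langle m' : m' \text{ precedes } m\rangle : m$ is generated by a set of variables. Writing $\mathrm{set}(m)$ for the set of all variables contained in this colon ideal, we have \[ \mathrm{set}(x_iy_jz_k)=\{x_1,\dots,x_{i-1}\}\cup\{y_{i+1},\dots,y_{j-1}\}\cup\{z_{j+1},\dots,z_{k-1}\}, \] and hence $|\mathrm{set}(x_iy_jz_k)|=k-3$. Moreover, for every $\ell\ge 0$, the $\ell$-th Betti number $\beta_\ell(M_{\mathrm{Diag}(n)})=\dim_K \mathrm{Tor}^R_\ell(K,M_{\mathrm{Diag}(n)})$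 (that is, the rank of the $\ell$-th free module in the minimal graded free resolution of the $R$-module $M_{\mathrm{Diag}(n)}$) is \[ \beta_\ell(M_{\mathrm{Diag}(n)})=\sum_{k=3}^{n}\binom{k-1}{2}\binom{k-3}{\ell}. \] -/

import Mathlib

universe u

namespace MatchingField

noncomputable section

open MvPolynomial CategoryTheory

/-! ### Linear quotients of monomial ideals -/

section LinearQuotients

variable {K : Type u} [Field K] {σ : Type} {ι : Type} [LinearOrder ι]

/-- For a family `m` of polynomials indexed by a linear order, the colon ideal
`⟨m s : s < t⟩ : m t`. -/
def colonBefore (m : ι → MvPolynomial σ K) (t : ι) : Ideal (MvPolynomial σ K) :=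
  (Ideal.span (m '' {s | s < t})).colon {m t}

/-- `set(m t)`: the set of those variables that lie in `⟨m s : s < t⟩ : m t`. -/
def linearQuotientSet (m : ι → MvPolynomial σ K) (t : ι) : Set σ :=
  {v | (X v : MvPolynomial σ K) ∈ colonBefore m t}

/-- The finite, linearly ordered family `m` consists of the minimal monomial generators of the
ideal `I`, and `I` has linear quotients with respect to this ordering of its generators: each
colon ideal `⟨m s : s < t⟩ : m t` is generated by a set of variables. -/
structure HasLinearQuotientsWith (I : Ideal (MvPolynomial σ K))
    (m : ι → MvPolynomial σ K) : Prop where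
  finite : Finite ι
  isMonomial : ∀ t, ∃ e : σ →₀ ℕ, m t = monomial e 1
  span_eq : Ideal.span (Set.range m) = I
  minimal : ∀ s t, m s ∣ m t → s = t
  colon_eq : ∀ t, ∃ V : Set σ, colonBefore m t = Ideal.span (X '' V)

end LinearQuotients

/-! ### Betti numbers -/

section Betti

variable (K : Type u) [Field K] (σ : Type)

/-- The residue field `K = K[σ] / ⟨all variables⟩`, as a module over the polynomial ring. -/
def residueModule : ModuleCat.{u} (MvPolynomial σ K) :=
  ModuleCat.of (MvPolynomial σ K)
    (MvPolynomial σ K ⧸ Ideal.span (Set.range (X : σ → MvPolynomial σ K)))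

variable {K σ}

/-- The `ℓ`-th (total) Betti number of an ideal `I` of the polynomial ring `R = K[σ]`, regarded as
an `R`-module: the dimension over `K` of `Tor_ℓ^R(K, I)`. -/
def bettiNumber (I : Ideal (MvPolynomial σ K)) (ℓ : ℕ) : Cardinal.{u} :=
  Module.rank K ((ModuleCat.restrictScalars (C : K →+* MvPolynomial σ K)).obj
    (((Tor (ModuleCat.{u} (MvPolynomial σ K)) ℓ).obj (residueModule K σ)).obj
      (ModuleCat.of (MvPolynomial σ K) I)))

end Betti

/-! ### The ideal of the diagonal matching field -/

/-- The index set `{1, …, n}`. -/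
abbrev Idx (n : ℕ) : Type := Set.Icc 1 n

/-- The `3n` variables `x_1, …, x_n, y_1, …, y_n, z_1, …, z_n`. -/
inductive Var (n : ℕ) : Type
  | x (i : Idx n) : Var n
  | y (j : Idx n) : Var n
  | z (k : Idx n) : Var n

/-- Triples `1 ≤ i < j < k ≤ n`. -/
@[ext]
structure Triple (n : ℕ) : Type where
  i : Idx n
  j : Idx n
  k : Idx n
  hij : i < j
  hjk : j < k

/-- The lexicographic order on triples: compare `i`, then `j`, then `k`. -/
instance (n : ℕ) : LinearOrder (Triple n) :=
  LinearOrder.lift' (fun t : Triple n => toLex (t.i, toLex (t.j, t.k))) (by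
    intro s t h
    have h1 := Prod.ext_iff.1 (toLex.injective h)
    have h2 := Prod.ext_iff.1 (toLex.injective h1.2)
    exact Triple.ext h1.1 h2.1 h2.2)

/-- The monomial `x_i y_j z_k` attached to a triple `i < j < k`. -/
def diagMonomial (K : Type u) [Field K] (n : ℕ) (t : Triple n) : MvPolynomial (Var n) K :=
  X (Var.x t.i) * X (Var.y t.j) * X (Var.z t.k)

/-- The ideal `⟨x_i y_j z_k : 1 ≤ i < j < k ≤ n⟩`. -/
def diagIdeal (K : Type u) [Field K] (n : ℕ) : Ideal (MvPolynomial (Var n) K) :=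
  Ideal.span {p | ∃ i j k : Idx n, i < j ∧ j < k ∧ p = X (Var.x i) * X (Var.y j) * X (Var.z k)}

end

end MatchingField

/-!
The proof computes the Betti numbers of any ideal generated in a single degree with linear
quotients, and then treats the combinatorics of the triples `i < j < k`.

Let `I` be such an ideal with generators `m_1, …, m_r`. Adjoining `m_t` to `⟨m_1, …, m_{t-1}⟩`
gives an extension by the cyclic module `R ⧸ (⟨m_1, …, m_{t-1}⟩ : m_t)`, which is a quotient of `R`
by variables (`isGradedExtension_adjoin`). The horseshoe lemma builds a free resolution of the
middle term of such an extension from resolutions of its ends. If these two resolutions have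
matrices of linear forms as differentials, the one in the middle can be chosen with linear
differentials as well: the relations between generators of one degree form a graded module, so the
degree one component of a lift of a linear syzygy is again a lift
(`IsGradedExtension.exists_syzygy`). Hence linear resolutions exist, and their ranks add up
(`IsGradedExtension.hasLinearResolution`). No separate construction of the Koszul complex is
needed, since the first syzygies of `R ⧸ ⟨V⟩` are the ideal `⟨V⟩`, which is itself obtained by
adjoining one variable after the other; this leads to the ranks `|V|.choose ℓ`
(`hasLinearResolution_cyclic_span_X`). A resolution by linear forms has zero differentials after
tensoring with the residue field, so its ranks are the Betti numbers
(`bettiNumber_eq_of_hasLinearResolution`), and these are `∑ t, |set(m_t)|.choose ℓ`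
(`bettiNumber_of_hasLinearQuotientsWith`).

For the diagonal matching field, membership in the colon ideals is a question about monomials,
answered by `exists_diagExponent_le_iff`. There are `(k - 1).choose 2` triples with last index `k`,
each with `|set| = k - 3`, which gives the final formula.
-/

namespace MatchingField

noncomputable section

open MvPolynomial CategoryTheory

/-! ### Relation modules and linear resolutions -/

section LinearResolutions

variable {K : Type u} [Field K] {σ : Type}

attribute [local instance] MvPolynomial.gradedAlgebra in
lemma homogeneousComponent_mul_of_isHomogeneous {q : MvPolynomial σ K} {e : ℕ}
    (hq : q.IsHomogeneous e) (p : MvPolynomial σ K) (d : ℕ) :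
    homogeneousComponent (d + e) (p * q) = homogeneousComponent d p * q := by
  rw [← decomposition.decompose'_apply, ← decomposition.decompose'_apply]
  exact DirectSum.coe_decompose_mul_add_of_right_mem (homogeneousSubmodule σ K) hq

variable (K σ) in
/-- A finitely generated module over `K[σ]` presented as the quotient of the free module `R^ι` by
a submodule of relations. Only the relations are recorded; the generators of the module are the
classes of the standard basis vectors. -/
structure Presentation : Type (u + 1) where
  /-- The index type of the generators. -/
  ι : Type
  [fintype : Fintype ι]
  /-- The relations between the generators. -/
  rel : Submodule (MvPolynomial σ K) (ι → MvPolynomial σ K)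

attribute [instance] Presentation.fintype

/-- The presentation of the module generated by the finite family `g`. -/
@[simps]
def Presentation.ofFamily {M : Type*} [AddCommGroup M] [Module (MvPolynomial σ K) M] {ι : Type}
    [Fintype ι] (g : ι → M) : Presentation K σ where
  ι := ι
  rel := LinearMap.ker (Fintype.linearCombination (MvPolynomial σ K) g)

/-- `Q` is a presentation of the first syzygy module `P.rel` of `P`, by generators whose entries
are linear forms. -/
def IsLinearSyzygy (P Q : Presentation K σ) : Prop :=
  ∃ w : Q.ι → P.ι → MvPolynomial σ K, (∀ j i, (w j i).IsHomogeneous 1) ∧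
    LinearMap.range (Fintype.linearCombination (MvPolynomial σ K) w) = P.rel ∧
    Q.rel = LinearMap.ker (Fintype.linearCombination (MvPolynomial σ K) w)

/-- The module presented by `P` has a free resolution, starting with the given generators, all of
whose differentials are matrices of linear forms, and whose `n`-th term has rank `b n`. The
resolution is encoded as the sequence of its successive syzygy modules. -/
def HasLinearResolution (P : Presentation K σ) (b : ℕ → ℕ) : Prop :=
  ∃ s : ℕ → Presentation K σ, s 0 = P ∧ (∀ n, IsLinearSyzygy (s n) (s (n + 1))) ∧
    ∀ n, Fintype.card (s n).ι = b n

lemma HasLinearResolution.cons {P Q : Presentation K σ} {b : ℕ → ℕ} (hPQ : IsLinearSyzygy P Q)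
    (hQ : HasLinearResolution Q fun n => b (n + 1)) (hP : Fintype.card P.ι = b 0) :
    HasLinearResolution P b := by
  obtain ⟨s, rfl, hs, hb⟩ := hQ
  refine ⟨fun n => Nat.casesOn n P s, rfl, fun n => ?_, fun n => ?_⟩
  · cases n with
    | zero => exact hPQ
    | succ n => exact hs n
  · cases n with
    | zero => exact hP
    | succ n => exact hb n

/-- A module without generators and relations has the zero resolution. -/
lemma HasLinearResolution.of_isEmpty {M : Type*} [AddCommGroup M] [Module (MvPolynomial σ K) M]
    {ι : Type} [Fintype ι] [IsEmpty ι] (g : ι → M) :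
    HasLinearResolution (.ofFamily (K := K) (σ := σ) g) fun _ => 0 := by
  have hι : IsEmpty (Presentation.ofFamily (K := K) (σ := σ) g).ι := ‹IsEmpty ι›
  refine ⟨fun _ => .ofFamily g, rfl, fun _ => ⟨fun i => hι.elim i, fun i => hι.elim i, ?_, ?_⟩,
    fun _ => Fintype.card_eq_zero (α := ι)⟩
  · refine Submodule.ext fun r => ?_
    rw [Subsingleton.elim r 0]
    exact iff_of_true (Submodule.zero_mem _) (Submodule.zero_mem _)
  · refine Submodule.ext fun r => ?_
    rw [Subsingleton.elim r 0]
    exact iff_of_true (Submodule.zero_mem _) (Submodule.zero_mem _)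

/-- `B` is an extension of `C` by `A` at the level of presentations: the generators of `B` are
those of `A` together with lifts of those of `C`, and `0 → A.rel → B.rel → C.rel → 0` is exact.
Moreover the relations of `B` form a graded submodule of the free module, whose basis vectors all
have the same degree. -/
structure IsGradedExtension (A B C : Presentation K σ) (e : B.ι ≃ A.ι ⊕ C.ι) : Prop where
  homogeneousComponent_mem : ∀ r ∈ B.rel, ∀ d, (fun i => homogeneousComponent d (r i)) ∈ B.rel
  inl_mem : ∀ a, Sum.elim a (0 : C.ι → MvPolynomial σ K) ∘ e ∈ B.rel ↔ a ∈ A.rel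
  inr_mem : ∀ a c, Sum.elim a c ∘ e ∈ B.rel → c ∈ C.rel
  exists_lift : ∀ c ∈ C.rel, ∃ a, Sum.elim a c ∘ e ∈ B.rel

/-- Relations between vectors whose entries are homogeneous of one fixed degree form a graded
submodule. -/
lemma homogeneousComponent_mem_ker {α β : Type} [Fintype β] {e : ℕ}
    (w : β → α → MvPolynomial σ K) (hw : ∀ j i, (w j i).IsHomogeneous e)
    (r : β → MvPolynomial σ K)
    (hr : r ∈ LinearMap.ker (Fintype.linearCombination (MvPolynomial σ K) w)) (d : ℕ) :
    (fun j => homogeneousComponent d (r j)) ∈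
      LinearMap.ker (Fintype.linearCombination (MvPolynomial σ K) w) := by
  rw [LinearMap.mem_ker, Fintype.linearCombination_apply] at hr ⊢
  ext1 i
  have h := congrArg (homogeneousComponent (d + e)) (congrFun hr i)
  simpa [Finset.sum_apply, homogeneousComponent_mul_of_isHomogeneous (hw _ i)] using h

/-- The horseshoe lemma for linear syzygies. A generating syzygy of `C` lifts to a relation of `B`,
and by gradedness its component of degree one is still a lift: so the lift can be chosen with
linear entries. -/
lemma IsGradedExtension.exists_syzygy {A B C A' C' : Presentation K σ} {e : B.ι ≃ A.ι ⊕ C.ι}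
    (h : IsGradedExtension A B C e) (hA : IsLinearSyzygy A A') (hC : IsLinearSyzygy C C') :
    ∃ (B' : Presentation K σ) (e' : B'.ι ≃ A'.ι ⊕ C'.ι),
      IsLinearSyzygy B B' ∧ IsGradedExtension A' B' C' e' := by
  obtain ⟨u, hu, hur, hA'⟩ := hA
  obtain ⟨v, hv, hvr, hC'⟩ := hC
  have hvmem : ∀ j, v j ∈ C.rel := fun j => by
    rw [← hvr, Fintype.range_linearCombination]
    exact Submodule.subset_span ⟨j, rfl⟩
  have humem : ∀ j, u j ∈ A.rel := fun j => by
    rw [← hur, Fintype.range_linearCombination]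
    exact Submodule.subset_span ⟨j, rfl⟩
  have hlift : ∀ j, ∃ a : A.ι → MvPolynomial σ K, (∀ i, (a i).IsHomogeneous 1) ∧
      Sum.elim a (v j) ∘ e ∈ B.rel := by
    intro j
    obtain ⟨a, ha⟩ := h.exists_lift _ (hvmem j)
    refine ⟨fun i => homogeneousComponent 1 (a i),
      fun i => homogeneousComponent_isHomogeneous 1 _, ?_⟩
    convert! h.homogeneousComponent_mem _ ha 1 using 1
    ext1 i
    simp only [Function.comp_apply]
    cases e i with
    | inl x => rfl
    | inr x => simp [homogeneousComponent_eq_self (hv j x)]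
  choose l hl hlmem using hlift
  -- The syzygies of `B` are generated by those of `A` and the linear lifts of those of `C`.
  let w : A'.ι ⊕ C'.ι → B.ι → MvPolynomial σ K :=
    Sum.elim (fun j => Sum.elim (u j) 0 ∘ e) (fun j => Sum.elim (l j) (v j) ∘ e)
  have hw : ∀ j i, (w j i).IsHomogeneous 1 := by
    rintro (j | j) i
    · simp only [w, Sum.elim_inl, Function.comp_apply]
      cases e i with
      | inl x => exact hu j x
      | inr x => exact isHomogeneous_zero _ _ _
    · simp only [w, Sum.elim_inr, Function.comp_apply]
      cases e i with
      | inl x => exact hl j x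
      | inr x => exact hv j x
  have hwmem : ∀ j, w j ∈ B.rel := by
    rintro (j | j)
    · exact (h.inl_mem _).2 (humem j)
    · exact hlmem j
  have hlc : ∀ a c, Fintype.linearCombination (MvPolynomial σ K) w (Sum.elim a c) =
      Sum.elim (Fintype.linearCombination (MvPolynomial σ K) u a +
        Fintype.linearCombination (MvPolynomial σ K) l c)
        (Fintype.linearCombination (MvPolynomial σ K) v c) ∘ e := by
    intro a c
    ext1 i
    obtain ⟨i, rfl⟩ := e.symm.surjective i
    cases i <;> simp [w, Fintype.linearCombination_apply]
  have hsub : ∀ r, Fintype.linearCombination (MvPolynomial σ K) w r ∈ B.rel := fun r => by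
    rw [Fintype.linearCombination_apply]
    exact Submodule.sum_mem _ fun j _ => Submodule.smul_mem _ _ (hwmem j)
  refine ⟨.ofFamily w, Equiv.refl _, ⟨w, hw, le_antisymm ?_ ?_, rfl⟩, ?_, ?_, ?_, ?_⟩
  · rintro _ ⟨r, rfl⟩
    exact hsub r
  · intro r hr
    obtain ⟨a, c, rfl⟩ : ∃ a c, r = Sum.elim a c ∘ e :=
      ⟨fun i => r (e.symm (.inl i)), fun i => r (e.symm (.inr i)), by
        ext1 i
        obtain ⟨j, rfl⟩ := e.symm.surjective i
        cases j <;> simp⟩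
    obtain ⟨c', rfl⟩ : c ∈ LinearMap.range (Fintype.linearCombination (MvPolynomial σ K) v) := by
      rw [hvr]
      exact h.inr_mem _ _ hr
    obtain ⟨a', ha'⟩ : a - Fintype.linearCombination (MvPolynomial σ K) l c' ∈
        LinearMap.range (Fintype.linearCombination (MvPolynomial σ K) u) := by
      rw [hur, ← h.inl_mem]
      convert! B.rel.sub_mem hr (hsub (Sum.elim 0 c')) using 1
      rw [hlc]
      ext1 i
      obtain ⟨i, rfl⟩ := e.symm.surjective i
      cases i <;> simp
    refine ⟨Sum.elim a' c', (hlc a' c').trans ?_⟩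
    rw [ha', sub_add_cancel]
  · exact homogeneousComponent_mem_ker w hw
  · intro a
    change Fintype.linearCombination (MvPolynomial σ K) w (Sum.elim a 0) = 0 ↔ _
    rw [hlc, map_zero, map_zero, add_zero, hA', LinearMap.mem_ker]
    refine ⟨fun H => ?_, fun H => ?_⟩
    · ext1 x
      simpa using congrFun H (e.symm (.inl x))
    · ext1 i
      obtain ⟨i, rfl⟩ := e.symm.surjective i
      cases i <;> simp [H]
  · intro a c H
    change Fintype.linearCombination (MvPolynomial σ K) w (Sum.elim a c) = 0 at H
    rw [hlc] at H
    rw [hC', LinearMap.mem_ker]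
    ext1 x
    simpa using congrFun H (e.symm (.inr x))
  · intro c hc
    have hc' : Fintype.linearCombination (MvPolynomial σ K) v c = 0 := by
      simpa [hC'] using hc
    have h0 := hsub (Sum.elim 0 c)
    rw [hlc, hc', map_zero, zero_add, h.inl_mem, ← hur] at h0
    obtain ⟨a, ha⟩ := h0
    refine ⟨-a, ?_⟩
    change Fintype.linearCombination (MvPolynomial σ K) w (Sum.elim (-a) c) = 0
    rw [hlc, hc', map_neg, ha, neg_add_cancel]
    ext1 i
    obtain ⟨i, rfl⟩ := e.symm.surjective i
    cases i <;> simp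

/-- Linear resolutions of the two ends of a graded extension combine to one of the middle term,
and the ranks add up. -/
lemma IsGradedExtension.hasLinearResolution {A B C : Presentation K σ} {e : B.ι ≃ A.ι ⊕ C.ι}
    (h : IsGradedExtension A B C e) {a c : ℕ → ℕ} (hA : HasLinearResolution A a)
    (hC : HasLinearResolution C c) : HasLinearResolution B fun n => a n + c n := by
  obtain ⟨s, rfl, hs, hsa⟩ := hA
  obtain ⟨t, rfl, ht, htc⟩ := hC
  -- The resolution is built recursively; each step must again be an extension of the given terms.
  let T (n : ℕ) : Type (u + 1) :=
    {B : Presentation K σ // ∃ e : B.ι ≃ (s n).ι ⊕ (t n).ι, IsGradedExtension (s n) B (t n) e}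
  have hstep : ∀ n (B : T n), ∃ B' : T (n + 1), IsLinearSyzygy B.1 B'.1 := by
    rintro n ⟨B, e, he⟩
    obtain ⟨B', e', hB, he'⟩ := he.exists_syzygy (hs n) (ht n)
    exact ⟨⟨B', e', he'⟩, hB⟩
  choose f hf using hstep
  let r : ∀ n, T n := fun n => Nat.rec (motive := T) ⟨B, e, h⟩ f n
  refine ⟨fun n => (r n).1, rfl, fun n => hf n (r n), fun n => ?_⟩
  obtain ⟨e', -⟩ := (r n).2
  rw [Fintype.card_congr e', Fintype.card_sum, hsa, htc]

end LinearResolutions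

/-! ### Linear resolutions from linear quotients -/

section LinearQuotientResolutions

variable {K : Type u} [Field K] {σ : Type}

/-- The presentation of the cyclic module `R ⧸ I` by its generator `1`. -/
@[simps]
def Presentation.cyclic (I : Ideal (MvPolynomial σ K)) : Presentation K σ where
  ι := Unit
  rel := Submodule.comap
    (LinearMap.proj () : (Unit → MvPolynomial σ K) →ₗ[MvPolynomial σ K] MvPolynomial σ K) I

/-- Adjoining one generator `m` to the ideal `⟨g⟩` extends it by the cyclic module
`R ⧸ (⟨g⟩ : m)`. -/
lemma isGradedExtension_adjoin {α β : Type} [Fintype α] [Fintype β] (e : β ≃ α ⊕ Unit)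
    {g : α → MvPolynomial σ K} {m : MvPolynomial σ K} {f : β → MvPolynomial σ K}
    (hf : ∀ b, f b = Sum.elim g (fun _ => m) (e b)) {d : ℕ} (hd : ∀ b, (f b).IsHomogeneous d) :
    IsGradedExtension (.ofFamily g) (.ofFamily f)
      (.cyclic ((Ideal.span (Set.range g)).colon {m})) e := by
  have hlc : ∀ a c, Fintype.linearCombination (MvPolynomial σ K) f (Sum.elim a c ∘ e) =
      Fintype.linearCombination (MvPolynomial σ K) g a + c () * m := by
    intro a c
    simp only [Fintype.linearCombination_apply, hf, Function.comp_apply]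
    rw [e.sum_comp (fun x => Sum.elim a c x • Sum.elim g (fun _ => m) x)]
    simp
  have hspan : ∀ p, p ∈ (Ideal.span (Set.range g)).colon {m} ↔
      ∃ a, Fintype.linearCombination (MvPolynomial σ K) g a = p * m := by
    intro p
    rw [Submodule.mem_colon_singleton, Ideal.span, ← Fintype.range_linearCombination,
      LinearMap.mem_range, smul_eq_mul]
  refine ⟨fun (r : β → MvPolynomial σ K) hr n => ?_, fun (a : α → MvPolynomial σ K) => ?_,
    fun (a : α → MvPolynomial σ K) (c : Unit → MvPolynomial σ K) h => ?_,
    fun (c : Unit → MvPolynomial σ K) h => ?_⟩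
  · change Fintype.linearCombination (MvPolynomial σ K) f
      (fun b : β => homogeneousComponent n (r b)) = 0
    replace hr : Fintype.linearCombination (MvPolynomial σ K) f r = 0 := hr
    rw [Fintype.linearCombination_apply] at hr ⊢
    have h := congrArg (homogeneousComponent (n + d)) hr
    simpa [homogeneousComponent_mul_of_isHomogeneous (hd _)] using h
  · change Fintype.linearCombination (MvPolynomial σ K) f (Sum.elim a 0 ∘ e) = 0 ↔
      Fintype.linearCombination (MvPolynomial σ K) g a = 0
    rw [hlc]
    simp
  · change Fintype.linearCombination (MvPolynomial σ K) f (Sum.elim a c ∘ e) = 0 at h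
    change c () ∈ (Ideal.span (Set.range g)).colon {m}
    rw [hlc] at h
    exact (hspan _).2 ⟨-a, by rw [map_neg, neg_eq_of_add_eq_zero_right h]⟩
  · change c () ∈ (Ideal.span (Set.range g)).colon {m} at h
    obtain ⟨a, ha⟩ := (hspan _).1 h
    refine ⟨-a, ?_⟩
    change Fintype.linearCombination (MvPolynomial σ K) f (Sum.elim (-a) c ∘ e) = 0
    rw [hlc, map_neg, ha, neg_add_cancel]

/-- The first syzygies of `R ⧸ ⟨V⟩` are the ideal `⟨V⟩`, whose generators are linear forms. -/
lemma isLinearSyzygy_cyclic_span_X (V : Finset σ) :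
    IsLinearSyzygy (.cyclic (Ideal.span (X '' (V : Set σ))))
      (.ofFamily (K := K) (σ := σ) fun v : V => (X v.1 : MvPolynomial σ K)) := by
  refine ⟨fun v _ => X v.1, fun v _ => isHomogeneous_X _ _, ?_, ?_⟩
  · refine Submodule.ext fun (r : Unit → MvPolynomial σ K) => ?_
    change r ∈ LinearMap.range (Fintype.linearCombination (MvPolynomial σ K)
      fun (v : V) (_ : Unit) => (X v.1 : MvPolynomial σ K)) ↔ r () ∈ Ideal.span (X '' (V : Set σ))
    have : (X '' (V : Set σ) : Set (MvPolynomial σ K)) = Set.range fun v : V => X v.1 := by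
      rw [Set.image_eq_range]
      rfl
    rw [this, Ideal.span, ← Fintype.range_linearCombination, LinearMap.mem_range,
      LinearMap.mem_range]
    refine exists_congr fun a => ⟨fun h => ?_, fun h => ?_⟩
    · rw [← h]
      simp [Fintype.linearCombination_apply]
    · ext1 i
      rw [← h]
      simp [Fintype.linearCombination_apply]
  · refine Submodule.ext fun (r : V → MvPolynomial σ K) => ?_
    change Fintype.linearCombination (MvPolynomial σ K) (fun v : V => (X v.1 : MvPolynomial σ K)) r
      = 0 ↔ Fintype.linearCombination (MvPolynomial σ K) (fun (v : V) (_ : Unit) =>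
        (X v.1 : MvPolynomial σ K)) r = 0
    simp [Fintype.linearCombination_apply, _root_.funext_iff]

lemma X_mem_span_X_image {V : Set σ} {v : σ} :
    (X v : MvPolynomial σ K) ∈ Ideal.span (X '' V) ↔ v ∈ V := by
  classical
  rw [mem_ideal_span_X_image]
  simp [support_X, Finsupp.single_apply]

/-- Distinct variables are prime to each other. -/
lemma colon_span_X_image {V : Set σ} {v : σ} (hv : v ∉ V) :
    (Ideal.span (X '' V : Set (MvPolynomial σ K))).colon {X v} = Ideal.span (X '' V) := by
  ext p
  rw [Submodule.mem_colon_singleton, smul_eq_mul]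
  refine ⟨fun h => ?_, fun h => Ideal.mul_mem_right _ _ h⟩
  rw [mem_ideal_span_X_image] at h ⊢
  intro u hu
  obtain ⟨i, hi, hui⟩ := h (u + Finsupp.single v 1) (by
    rw [mem_support_iff, coeff_mul_X]
    exact mem_support_iff.1 hu)
  refine ⟨i, hi, ?_⟩
  rwa [Finsupp.add_apply, Finsupp.single_eq_of_ne (by rintro rfl; exact hv hi), add_zero] at hui

/-- The ideal generated by `r` variables has the linear resolution given by the truncated Koszul
complex, with ranks `r.choose (n + 1)`. -/
lemma hasLinearResolution_X (V : Finset σ) :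
    HasLinearResolution (.ofFamily (K := K) (σ := σ) fun v : V => (X v.1 : MvPolynomial σ K))
      fun n => V.card.choose (n + 1) := by
  classical
  induction V using Finset.induction_on with
  | empty =>
    simpa using HasLinearResolution.of_isEmpty (K := K)
      fun v : (∅ : Finset σ) => (X v.1 : MvPolynomial σ K)
  | insert v V hv ih =>
    have h := isGradedExtension_adjoin (K := K) (g := fun v : V => X v.1) (m := X v)
      (f := fun w : (insert v V : Finset σ) => X w.1)
      ((Finset.subtypeInsertEquivOption hv).trans (Equiv.optionEquivSumPUnit _))
      (fun w => by
        by_cases hw : w.1 = v <;> simp [Finset.subtypeInsertEquivOption, hw])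
      (fun w => isHomogeneous_X _ _)
    have hrange : (Set.range fun v : V => (X v.1 : MvPolynomial σ K)) = X '' (V : Set σ) := by
      rw [Set.image_eq_range]
      rfl
    rw [hrange, colon_span_X_image (by simpa using hv)] at h
    have hcyc := (ih.cons (b := fun n => V.card.choose n) (isLinearSyzygy_cyclic_span_X V)
      (by simp))
    convert! h.hasLinearResolution ih hcyc using 2 with n
    rw [Finset.card_insert_of_notMem hv, Nat.choose_succ_succ, add_comm]

/-- The Koszul complex on `r` variables, with ranks `r.choose n`, resolves the quotient by these
variables. -/
lemma hasLinearResolution_cyclic_span_X (V : Finset σ) :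
    HasLinearResolution (.cyclic (K := K) (Ideal.span (X '' (V : Set σ))))
      fun n => V.card.choose n :=
  (hasLinearResolution_X V).cons (isLinearSyzygy_cyclic_span_X V) (by simp)

/-- An ideal generated in a single degree with linear quotients has a linear resolution, to which
a generator with colon ideal generated by `r` variables contributes the rank `r.choose n` in
homological degree `n`. -/
lemma hasLinearResolution_of_linearQuotients {ι : Type} [LinearOrder ι]
    (m : ι → MvPolynomial σ K) {d : ℕ} (hd : ∀ t, (m t).IsHomogeneous d) (V : ι → Finset σ)
    (S : Finset ι)
    (hS : ∀ t ∈ S, (Ideal.span (m '' {s | s ∈ S ∧ s < t})).colon {m t} =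
      Ideal.span (X '' (V t : Set σ))) :
    HasLinearResolution (.ofFamily (K := K) (σ := σ) fun s : S => m s.1)
      fun n => ∑ t ∈ S, (V t).card.choose n := by
  induction S using Finset.induction_on_max with
  | empty =>
    simpa using HasLinearResolution.of_isEmpty (K := K) (σ := σ) fun s : (∅ : Finset ι) => m s.1
  | insert a S ha ih =>
    have haS : a ∉ S := fun h => (ha a h).false
    have h := isGradedExtension_adjoin (K := K) (g := fun s : S => m s.1) (m := m a)
      (f := fun s : (insert a S : Finset ι) => m s.1)
      ((Finset.subtypeInsertEquivOption haS).trans (Equiv.optionEquivSumPUnit _))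
      (fun w => by
        by_cases hw : w.1 = a <;> simp [Finset.subtypeInsertEquivOption, hw])
      (fun w => hd _)
    have hrange : (Set.range fun s : S => m s.1) = m '' {s | s ∈ insert a S ∧ s < a} := by
      have : {s | s ∈ insert a S ∧ s < a} = (S : Set ι) := by
        ext s
        simp only [Finset.mem_insert, Set.mem_ofPred_eq, Finset.mem_coe]
        exact ⟨fun h => h.1.resolve_left h.2.ne, fun h => ⟨.inr h, ha s h⟩⟩
      rw [this, Set.image_eq_range]
      rfl
    rw [hrange, hS a (Finset.mem_insert_self _ _)] at h
    have ih' := ih fun t ht => by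
      rw [← hS t (Finset.mem_insert_of_mem ht)]
      congr 4
      ext s
      simp only [Finset.mem_insert]
      refine ⟨fun h => ⟨.inr h.1, h.2⟩, fun h => ⟨h.1.resolve_left ?_, h.2⟩⟩
      rintro rfl
      exact (h.2.trans (ha t ht)).false
    convert! h.hasLinearResolution ih' (hasLinearResolution_cyclic_span_X (V a)) using 2 with n
    rw [Finset.sum_insert haS, add_comm]

end LinearQuotientResolutions

/-! ### Betti numbers from linear resolutions -/

section TorOfLinearResolution

variable {K : Type u} [Field K] {σ : Type}

lemma mem_span_range_X_iff (p : MvPolynomial σ K) :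
    p ∈ Ideal.span (Set.range (X : σ → MvPolynomial σ K)) ↔ constantCoeff p = 0 := by
  rw [← Set.image_univ, mem_ideal_span_X_image, constantCoeff_eq]
  refine ⟨fun h => ?_, fun h u hu => ?_⟩
  · by_contra h0
    obtain ⟨i, -, hi⟩ := h 0 (mem_support_iff.2 h0)
    exact hi rfl
  · by_contra! H
    have : u = 0 := Finsupp.ext fun i => H i (Set.mem_univ i)
    rw [this, mem_support_iff] at hu
    exact hu h

lemma mem_span_range_X_of_isHomogeneous_one {p : MvPolynomial σ K} (hp : p.IsHomogeneous 1) :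
    p ∈ Ideal.span (Set.range (X : σ → MvPolynomial σ K)) := by
  rw [mem_span_range_X_iff, constantCoeff_eq]
  by_contra h
  simpa using hp h

variable (K σ) in
/-- The residue field `R ⧸ ⟨all variables⟩` is `K`. -/
def residueRingEquiv :
    (MvPolynomial σ K ⧸ Ideal.span (Set.range (X : σ → MvPolynomial σ K))) ≃+* K :=
  (Ideal.quotEquivOfEq (Ideal.ext fun p => by
    rw [mem_span_range_X_iff, RingHom.mem_ker])).trans
    (RingHom.quotientKerEquivOfSurjective (f := constantCoeff (σ := σ) (R := K))
      fun c => ⟨C c, constantCoeff_C _ c⟩)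

lemma residueRingEquiv_C_smul (c : K)
    (x : MvPolynomial σ K ⧸ Ideal.span (Set.range (X : σ → MvPolynomial σ K))) :
    residueRingEquiv K σ ((C c : MvPolynomial σ K) • x) = c * residueRingEquiv K σ x := by
  obtain ⟨p, rfl⟩ := Ideal.Quotient.mk_surjective x
  change constantCoeff (C c * p) = c * constantCoeff p
  rw [map_mul, constantCoeff_C]

/-- The `K`-dimension of `K ⊗ R^ι` is the rank of `R^ι`. -/
lemma rank_residueModule_tensor (ι : Type) [Fintype ι] :
    Module.rank K ((ModuleCat.restrictScalars (C : K →+* MvPolynomial σ K)).obj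
      (((MonoidalCategory.tensoringLeft (ModuleCat.{u} (MvPolynomial σ K))).obj
        (residueModule K σ)).obj (ModuleCat.of _ (ι → MvPolynomial σ K)))) = Fintype.card ι := by
  classical
  let e := TensorProduct.piScalarRight (MvPolynomial σ K) (MvPolynomial σ K)
    (MvPolynomial σ K ⧸ Ideal.span (Set.range (X : σ → MvPolynomial σ K))) ι
  rw [← rank_fun' (R := K) (η := ι)]
  let j : (ModuleCat.restrictScalars (C : K →+* MvPolynomial σ K)).obj
      (((MonoidalCategory.tensoringLeft (ModuleCat.{u} (MvPolynomial σ K))).obj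
        (residueModule K σ)).obj (ModuleCat.of _ (ι → MvPolynomial σ K))) ≃+ (ι → K) :=
    e.toAddEquiv.trans
      (AddEquiv.piCongrRight fun _ : ι => (residueRingEquiv K σ).toAddEquiv)
  refine rank_eq_of_equiv_equiv id j Function.bijective_id fun c x => ?_
  ext1 i
  refine (congrArg (fun y => residueRingEquiv K σ (y i)) (e.map_smul (C c) x)).trans ?_
  exact residueRingEquiv_C_smul c (e x i)

/-- A tensor vanishes in `K ⊗ R^ι` when the entries of its second factor lie in the ideal of the
variables. -/
lemma residue_tmul_eq_zero {ι : Type} [Fintype ι]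
    (x : MvPolynomial σ K ⧸ Ideal.span (Set.range (X : σ → MvPolynomial σ K)))
    {v : ι → MvPolynomial σ K}
    (hv : ∀ i, v i ∈ Ideal.span (Set.range (X : σ → MvPolynomial σ K))) :
    x ⊗ₜ[MvPolynomial σ K] v = 0 := by
  classical
  apply (TensorProduct.piScalarRight (MvPolynomial σ K) (MvPolynomial σ K)
    (MvPolynomial σ K ⧸ Ideal.span (Set.range (X : σ → MvPolynomial σ K))) ι).injective
  rw [map_zero, TensorProduct.piScalarRight_apply, TensorProduct.piScalarRightHom_tmul]
  ext1 i
  obtain ⟨p, rfl⟩ := Ideal.Quotient.mk_surjective x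
  exact Ideal.Quotient.eq_zero_iff_mem.2 (Ideal.mul_mem_right p _ (hv i))

/-- The chain complex of free modules given by a sequence of composable matrices. -/
def matrixComplex (ι : ℕ → Type) [∀ n, Fintype (ι n)]
    (w : ∀ n, ι (n + 1) → ι n → MvPolynomial σ K)
    (hw : ∀ n, Fintype.linearCombination (MvPolynomial σ K) (w n) ∘ₗ
      Fintype.linearCombination (MvPolynomial σ K) (w (n + 1)) = 0) :
    ChainComplex (ModuleCat.{u} (MvPolynomial σ K)) ℕ :=
  ChainComplex.of (fun n => ModuleCat.of _ (ι n → MvPolynomial σ K))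
    (fun n => ModuleCat.ofHom (Fintype.linearCombination (MvPolynomial σ K) (w n)))
    fun n => by rw [← ModuleCat.ofHom_comp, hw]; rfl

lemma matrixComplex_d (ι : ℕ → Type) [∀ n, Fintype (ι n)]
    (w : ∀ n, ι (n + 1) → ι n → MvPolynomial σ K) (hw) (n : ℕ) :
    (matrixComplex ι w hw).d (n + 1) n =
      ModuleCat.ofHom (Fintype.linearCombination (MvPolynomial σ K) (w n)) :=
  (ChainComplex.of_d (fun n => ModuleCat.of (MvPolynomial σ K) (ι n → MvPolynomial σ K))
    (fun n => ModuleCat.ofHom (Fintype.linearCombination (MvPolynomial σ K) (w n))) n :)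

lemma matrixComplex_exactAt_succ (ι : ℕ → Type) [∀ n, Fintype (ι n)]
    (w : ∀ n, ι (n + 1) → ι n → MvPolynomial σ K)
    (hw : ∀ n, Fintype.linearCombination (MvPolynomial σ K) (w n) ∘ₗ
      Fintype.linearCombination (MvPolynomial σ K) (w (n + 1)) = 0)
    (hex : ∀ n, LinearMap.ker (Fintype.linearCombination (MvPolynomial σ K) (w n)) ≤
      LinearMap.range (Fintype.linearCombination (MvPolynomial σ K) (w (n + 1)))) (n : ℕ) :
    (matrixComplex ι w hw).ExactAt (n + 1) := by
  rw [HomologicalComplex.exactAt_iff' _ (n + 1 + 1) (n + 1) n (by simp) (by simp),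
    ShortComplex.moduleCat_exact_iff]
  intro x hx
  change (matrixComplex ι w hw).d (n + 1) n x = 0 at hx
  rw [matrixComplex_d] at hx
  obtain ⟨y, hy⟩ := hex n hx
  refine ⟨y, ?_⟩
  change (matrixComplex ι w hw).d (n + 1 + 1) (n + 1) y = x
  rw [matrixComplex_d]
  exact hy

/-- An exact sequence of free modules augmented to `M` is a projective resolution of `M`. -/
def matrixResolution (ι : ℕ → Type) [∀ n, Fintype (ι n)]
    (w : ∀ n, ι (n + 1) → ι n → MvPolynomial σ K)
    (hw : ∀ n, Fintype.linearCombination (MvPolynomial σ K) (w n) ∘ₗ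
      Fintype.linearCombination (MvPolynomial σ K) (w (n + 1)) = 0)
    (hex : ∀ n, LinearMap.ker (Fintype.linearCombination (MvPolynomial σ K) (w n)) ≤
      LinearMap.range (Fintype.linearCombination (MvPolynomial σ K) (w (n + 1))))
    {M : Type u} [AddCommGroup M] [Module (MvPolynomial σ K) M]
    (φ : (ι 0 → MvPolynomial σ K) →ₗ[MvPolynomial σ K] M) (hφ : Function.Surjective φ)
    (hker : LinearMap.ker φ =
      LinearMap.range (Fintype.linearCombination (MvPolynomial σ K) (w 0))) :
    ProjectiveResolution (ModuleCat.of (MvPolynomial σ K) M) where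
  complex := matrixComplex ι w hw
  projective n := by
    change Projective (ModuleCat.of (MvPolynomial σ K) (ι n → MvPolynomial σ K))
    infer_instance
  π := (ChainComplex.toSingle₀Equiv _ _).symm ⟨ModuleCat.ofHom φ, by
    rw [matrixComplex_d]
    ext1
    exact LinearMap.range_le_ker_iff.1 hker.ge⟩
  quasiIso := ⟨fun n => by
    cases n
    · rw [ChainComplex.quasiIsoAt₀_iff, ShortComplex.quasiIso_iff_of_zeros']
      · refine ⟨?_, ?_⟩
        · rw [ShortComplex.moduleCat_exact_iff]
          intro x hx
          obtain ⟨y, hy⟩ := hker.le hx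
          refine ⟨y, ?_⟩
          change (matrixComplex ι w hw).d 1 0 y = x
          rw [matrixComplex_d]
          exact hy
        · rw [ModuleCat.epi_iff_surjective]
          exact hφ
      all_goals rfl
    · rw [quasiIsoAt_iff_exactAt']
      · exact matrixComplex_exactAt_succ ι w hw hex _
      · apply ChainComplex.exactAt_succ_single_obj⟩

/-- A complex with zero differentials is its own homology. -/
def homologyIsoOfZeroDifferentials {A : Type*} [Category* A] [Abelian A] (D : ChainComplex A ℕ)
    (h : ∀ i j, D.d i j = 0) (n : ℕ) : D.homology n ≅ D.X n :=
  (ShortComplex.HomologyData.ofZeros (D.sc n) (h _ _) (h _ _)).left.homologyIso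

lemma tensor_matrixComplex_d_eq_zero (ι : ℕ → Type) [∀ n, Fintype (ι n)]
    (w : ∀ n, ι (n + 1) → ι n → MvPolynomial σ K) (hw)
    (hlin : ∀ n j i, (w n j i).IsHomogeneous 1) (i j : ℕ) :
    ((((MonoidalCategory.tensoringLeft (ModuleCat.{u} (MvPolynomial σ K))).obj
      (residueModule K σ)).mapHomologicalComplex (ComplexShape.down ℕ)).obj
        (matrixComplex ι w hw)).d i j = 0 := by
  by_cases hij : i = j + 1
  · subst hij
    rw [Functor.mapHomologicalComplex_obj_d, matrixComplex_d]
    refine ModuleCat.MonoidalCategory.tensor_ext fun x v => ?_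
    refine residue_tmul_eq_zero x fun i => ?_
    change Fintype.linearCombination (MvPolynomial σ K) (w j)
      (show ι (j + 1) → MvPolynomial σ K from v) i ∈ _
    rw [Fintype.linearCombination_apply, Finset.sum_apply]
    exact Ideal.sum_mem _ fun k _ =>
      Ideal.mul_mem_left _ _ (mem_span_range_X_of_isHomogeneous_one (hlin _ _ _))
  · exact HomologicalComplex.shape _ _ _ fun h => hij h.symm

/-- The Betti numbers of a module are the ranks in a linear resolution: after tensoring with the
residue field all differentials vanish. -/
lemma bettiNumber_eq_of_hasLinearResolution {I : Ideal (MvPolynomial σ K)} {ι : Type} [Fintype ι]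
    {g : ι → MvPolynomial σ K} (hg : Ideal.span (Set.range g) = I) {b : ℕ → ℕ}
    (h : HasLinearResolution (.ofFamily (K := K) (σ := σ) g) b) (ℓ : ℕ) :
    bettiNumber I ℓ = (b ℓ : Cardinal.{u}) := by
  obtain ⟨s, hs0, hs, hb⟩ := h
  choose w hlin hrange hrel using hs
  obtain ⟨φ, hφ, hφker⟩ : ∃ φ : ((s 0).ι → MvPolynomial σ K) →ₗ[MvPolynomial σ K] I,
      Function.Surjective φ ∧ LinearMap.ker φ = (s 0).rel := by
    rw [hs0]
    have hmem : ∀ r, Fintype.linearCombination (MvPolynomial σ K) g r ∈ I := fun r => by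
      rw [← hg, Ideal.span, ← Fintype.range_linearCombination]
      exact ⟨r, rfl⟩
    refine ⟨(Fintype.linearCombination (MvPolynomial σ K) g).codRestrict I hmem, ?_, ?_⟩
    · rintro ⟨p, hp⟩
      rw [← hg, Ideal.span, ← Fintype.range_linearCombination] at hp
      obtain ⟨r, rfl⟩ := hp
      exact ⟨r, rfl⟩
    · exact LinearMap.ker_codRestrict _ _ _
  have hker : ∀ n, LinearMap.ker (Fintype.linearCombination (MvPolynomial σ K) (w n)) =
      LinearMap.range (Fintype.linearCombination (MvPolynomial σ K) (w (n + 1))) := fun n => by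
    rw [hrange, hrel]
  have hw : ∀ n, Fintype.linearCombination (MvPolynomial σ K) (w n) ∘ₗ
      Fintype.linearCombination (MvPolynomial σ K) (w (n + 1)) = 0 := fun n =>
    LinearMap.range_le_ker_iff.1 (hker n).ge
  let P := matrixResolution (fun n => (s n).ι) w hw (fun n => (hker n).le) φ hφ
    (by rw [hφker, hrange])
  let F := (MonoidalCategory.tensoringLeft (ModuleCat.{u} (MvPolynomial σ K))).obj
    (residueModule K σ)
  let e : ((Tor (ModuleCat.{u} (MvPolynomial σ K)) ℓ).obj (residueModule K σ)).obj
      (ModuleCat.of (MvPolynomial σ K) I) ≅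
      F.obj (ModuleCat.of _ ((s ℓ).ι → MvPolynomial σ K)) :=
    P.isoLeftDerivedObj F ℓ ≪≫ homologyIsoOfZeroDifferentials _
      (tensor_matrixComplex_d_eq_zero (fun n => (s n).ι) w hw hlin) ℓ
  rw [bettiNumber, ((ModuleCat.restrictScalars C).mapIso e).toLinearEquiv.rank_eq,
    rank_residueModule_tensor, hb]

end TorOfLinearResolution

section BettiOfLinearQuotients

variable {K : Type u} [Field K] {σ : Type} {ι : Type} [LinearOrder ι]

lemma linearQuotientSet_eq {m : ι → MvPolynomial σ K} {t : ι} {V : Set σ}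
    (h : colonBefore m t = Ideal.span (X '' V)) : linearQuotientSet m t = V := by
  ext v
  change X v ∈ colonBefore m t ↔ _
  rw [h, X_mem_span_X_image]

/-- The Betti numbers of an ideal generated in a single degree with linear quotients. -/
lemma bettiNumber_of_hasLinearQuotientsWith [Fintype ι] {I : Ideal (MvPolynomial σ K)}
    {m : ι → MvPolynomial σ K} (h : HasLinearQuotientsWith I m) {d : ℕ}
    (hd : ∀ t, (m t).IsHomogeneous d) (hfin : ∀ t, (linearQuotientSet m t).Finite) (ℓ : ℕ) :
    bettiNumber I ℓ = ((∑ t, (linearQuotientSet m t).ncard.choose ℓ : ℕ) : Cardinal.{u}) := by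
  have hcolon : ∀ t, colonBefore m t = Ideal.span (X '' linearQuotientSet m t) := fun t => by
    obtain ⟨V, hV⟩ := h.colon_eq t
    rw [hV, linearQuotientSet_eq hV]
  have hres := hasLinearResolution_of_linearQuotients m hd (fun t => (hfin t).toFinset) Finset.univ
    fun t _ => by simpa [colonBefore] using hcolon t
  have hspan : Ideal.span (Set.range fun s : (Finset.univ : Finset ι) => m s.1) = I := by
    rw [← h.span_eq]
    congr 1
    ext p
    simp
  rw [bettiNumber_eq_of_hasLinearResolution hspan hres]
  simp only [Set.ncard_eq_toFinset_card _ (hfin _)]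

end BettiOfLinearQuotients

/-! ### The diagonal matching field -/

section Diagonal

variable {n : ℕ}

lemma Triple.lt_iff (s t : Triple n) :
    s < t ↔ s.i < t.i ∨ s.i = t.i ∧ (s.j < t.j ∨ s.j = t.j ∧ s.k < t.k) := by
  change toLex (s.i, toLex (s.j, s.k)) < toLex (t.i, toLex (t.j, t.k)) ↔ _
  simp [Prod.Lex.toLex_lt_toLex]

instance : Finite (Triple n) :=
  Finite.of_injective (fun t : Triple n => (t.i, t.j, t.k)) fun s t h => by
    simp only [Prod.mk.injEq] at h
    exact Triple.ext h.1 h.2.1 h.2.2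

/-- The exponent vector of `x_i y_j z_k`. -/
def diagExponent (t : Triple n) : Var n →₀ ℕ :=
  Finsupp.single (Var.x t.i) 1 + Finsupp.single (Var.y t.j) 1 + Finsupp.single (Var.z t.k) 1

lemma diagMonomial_eq (K : Type u) [Field K] (t : Triple n) :
    diagMonomial K n t = monomial (diagExponent t) 1 := by
  simp [diagMonomial, diagExponent, X, monomial_mul]

lemma diagMonomial_isHomogeneous (K : Type u) [Field K] (t : Triple n) :
    (diagMonomial K n t).IsHomogeneous 3 :=
  ((isHomogeneous_X K _).mul (isHomogeneous_X K _)).mul (isHomogeneous_X K _)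

lemma diagExponent_le_add_iff (s t : Triple n) (u : Var n →₀ ℕ) :
    diagExponent s ≤ u + diagExponent t ↔ (s.i = t.i ∨ u (.x s.i) ≠ 0) ∧
      (s.j = t.j ∨ u (.y s.j) ≠ 0) ∧ (s.k = t.k ∨ u (.z s.k) ≠ 0) := by
  classical
  refine ⟨fun h => ⟨?_, ?_, ?_⟩, fun h v => ?_⟩
  · have := h (.x s.i)
    by_contra! H
    simp [diagExponent, H.2, Ne.symm H.1] at this
  · have := h (.y s.j)
    by_contra! H
    simp [diagExponent, H.2, Ne.symm H.1] at this
  · have := h (.z s.k)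
    by_contra! H
    simp [diagExponent, H.2, Ne.symm H.1] at this
  · cases v <;> simp [diagExponent, Finsupp.single_apply] <;> grind

/-- The variables in the colon ideal at `x_i y_j z_k`. -/
def diagVars (t : Triple n) : Set (Var n) :=
  Var.x '' {a | a < t.i} ∪ Var.y '' {b | t.i < b ∧ b < t.j} ∪ Var.z '' {c | t.j < c ∧ c < t.k}

/-- A monomial times `x_i y_j z_k` is divisible by an earlier generator exactly when the monomial
is divisible by one of the variables in `diagVars`: if the first index in which the earlier
generator differs is smaller, the variable with that index works, and conversely lowering that
single index of `x_i y_j z_k` gives an earlier generator. -/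
lemma exists_diagExponent_le_iff (t : Triple n) (u : Var n →₀ ℕ) :
    (∃ s < t, diagExponent s ≤ u + diagExponent t) ↔ ∃ v ∈ diagVars t, u v ≠ 0 := by
  simp only [diagExponent_le_add_iff, Triple.lt_iff]
  constructor
  · rintro ⟨s, h | ⟨hi, h | ⟨hj, h⟩⟩, hx, hy, hz⟩
    · exact ⟨.x s.i, .inl (.inl ⟨s.i, h, rfl⟩), hx.resolve_left h.ne⟩
    · exact ⟨.y s.j, .inl (.inr ⟨s.j, ⟨hi ▸ s.hij, h⟩, rfl⟩), hy.resolve_left h.ne⟩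
    · exact ⟨.z s.k, .inr ⟨s.k, ⟨hj ▸ s.hjk, h⟩, rfl⟩, hz.resolve_left h.ne⟩
  · rintro ⟨_, (⟨a, ha, rfl⟩ | ⟨b, ⟨hb, hb'⟩, rfl⟩) | ⟨c, ⟨hc, hc'⟩, rfl⟩, hu⟩
    · exact ⟨⟨a, t.j, t.k, ha.trans t.hij, t.hjk⟩, .inl ha, .inr hu, .inl rfl, .inl rfl⟩
    · exact ⟨⟨t.i, b, t.k, hb, hb'.trans t.hjk⟩, .inr ⟨rfl, .inl hb'⟩, .inl rfl, .inr hu, .inl rfl⟩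
    · exact ⟨⟨t.i, t.j, c, t.hij, hc⟩, .inr ⟨rfl, .inr ⟨rfl, hc'⟩⟩, .inl rfl, .inl rfl, .inr hu⟩

lemma colonBefore_diagMonomial (K : Type u) [Field K] (t : Triple n) :
    colonBefore (diagMonomial K n) t = Ideal.span (X '' diagVars t) := by
  have himage : diagMonomial K n '' {s | s < t} =
      (fun e => monomial e (1 : K)) '' (diagExponent '' {s | s < t}) := by
    rw [Set.image_image]
    exact Set.image_congr fun s _ => diagMonomial_eq K s
  ext p
  rw [colonBefore, Submodule.mem_colon_singleton, himage, mem_ideal_span_monomial_image,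
    mem_ideal_span_X_image, smul_eq_mul, diagMonomial_eq]
  constructor
  · intro h u hu
    obtain ⟨_, ⟨s, hs, rfl⟩, hle⟩ := h (u + diagExponent t) (by
      rw [mem_support_iff, coeff_mul_monomial, mul_one]
      exact mem_support_iff.1 hu)
    exact (exists_diagExponent_le_iff t u).1 ⟨s, hs, hle⟩
  · intro h v hv
    rw [mem_support_iff, coeff_mul_monomial'] at hv
    split_ifs at hv with htv
    · obtain ⟨s, hs, hle⟩ := (exists_diagExponent_le_iff t (v - diagExponent t)).2
        (h _ (mem_support_iff.2 (left_ne_zero_of_mul hv)))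
      rw [tsub_add_cancel_of_le htv] at hle
      exact ⟨_, ⟨s, hs, rfl⟩, hle⟩
    · exact absurd rfl hv

lemma hasLinearQuotientsWith_diagIdeal (K : Type u) [Field K] (n : ℕ) :
    HasLinearQuotientsWith (diagIdeal K n) (diagMonomial K n) where
  finite := inferInstance
  isMonomial t := ⟨_, diagMonomial_eq K t⟩
  span_eq := by
    rw [diagIdeal]
    congr 1
    ext p
    constructor
    · rintro ⟨t, rfl⟩
      exact ⟨t.i, t.j, t.k, t.hij, t.hjk, rfl⟩
    · rintro ⟨i, j, k, hij, hjk, rfl⟩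
      exact ⟨⟨i, j, k, hij, hjk⟩, rfl⟩
  minimal s t h := by
    rw [diagMonomial_eq, diagMonomial_eq, monomial_dvd_monomial] at h
    have hle := h.1.resolve_left one_ne_zero
    have := (diagExponent_le_add_iff s t 0).1 (by rwa [zero_add])
    simpa [Triple.ext_iff] using this
  colon_eq t := ⟨_, colonBefore_diagMonomial K t⟩

lemma ncard_setOf_idx (l r : ℕ) (hr : r ≤ n + 1) :
    {a : Idx n | l < (a : ℕ) ∧ (a : ℕ) < r}.ncard = r - l - 1 := by
  rw [← Set.ncard_image_of_injective _ Subtype.val_injective, ← Nat.card_Ioo,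
    ← Set.ncard_coe_finset]
  congr 1
  ext a
  simp only [Set.mem_image, Set.mem_ofPred_eq, Finset.coe_Ioo, Set.mem_Ioo]
  constructor
  · rintro ⟨b, hb, rfl⟩
    exact hb
  · intro h
    exact ⟨⟨a, by omega, by omega⟩, h, rfl⟩

instance : Finite (Var n) :=
  Finite.of_surjective (fun v : Idx n ⊕ Idx n ⊕ Idx n => v.elim Var.x (Sum.elim Var.y Var.z)) <| by
    rintro (i | j | k)
    · exact ⟨.inl i, rfl⟩
    · exact ⟨.inr (.inl j), rfl⟩
    · exact ⟨.inr (.inr k), rfl⟩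

/-- The three intervals of indices have `i - 1`, `j - i - 1` and `k - j - 1` elements. -/
lemma ncard_diagVars (t : Triple n) : (diagVars t).ncard = (t.k : ℕ) - 3 := by
  have hi : {a | a < t.i} = {a : Idx n | 0 < (a : ℕ) ∧ (a : ℕ) < t.i} := by
    ext a
    exact ⟨fun h => ⟨a.2.1, h⟩, fun h => h.2⟩
  have hx : (Var.x '' {a | a < t.i}).ncard = (t.i : ℕ) - 0 - 1 := by
    rw [Set.ncard_image_of_injective _ fun _ _ => Var.x.inj, hi]
    exact ncard_setOf_idx _ _ (t.i.2.2.trans (Nat.le_succ n))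
  have hy : (Var.y '' {b | t.i < b ∧ b < t.j}).ncard = (t.j : ℕ) - t.i - 1 := by
    rw [Set.ncard_image_of_injective _ fun _ _ => Var.y.inj]
    exact ncard_setOf_idx _ _ (t.j.2.2.trans (Nat.le_succ n))
  have hz : (Var.z '' {c | t.j < c ∧ c < t.k}).ncard = (t.k : ℕ) - t.j - 1 := by
    rw [Set.ncard_image_of_injective _ fun _ _ => Var.z.inj]
    exact ncard_setOf_idx _ _ (t.k.2.2.trans (Nat.le_succ n))
  rw [diagVars, Set.ncard_union_eq (by
      rw [Set.disjoint_left]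
      rintro _ (⟨a, -, rfl⟩ | ⟨b, -, rfl⟩) ⟨c, -, h⟩ <;> cases h),
    Set.ncard_union_eq (by
      rw [Set.disjoint_left]
      rintro _ ⟨a, -, rfl⟩ ⟨b, -, h⟩
      cases h), hx, hy, hz]
  have h1 : 1 ≤ (t.i : ℕ) := t.i.2.1
  have h2 : (t.i : ℕ) < t.j := t.hij
  have h3 : (t.j : ℕ) < t.k := t.hjk
  omega

/-- Triples with last index `k` correspond to pairs `i < j` in `{1, …, k - 1}`. -/
lemma card_triple_k_eq [Fintype (Triple n)] {k : ℕ} (hk : k ≤ n) :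
    (Finset.univ.filter fun t : Triple n => (t.k : ℕ) = k).card = (k - 1).choose 2 := by
  trans ((Finset.Ico 1 k).sigma fun j => Finset.Ico 1 j).card
  · refine Finset.card_bij (fun t _ => ⟨t.j, t.i⟩) ?_ ?_ ?_
    · intro t ht
      have h1 : 1 ≤ (t.i : ℕ) := t.i.2.1
      have h2 : (t.i : ℕ) < t.j := t.hij
      have h3 : (t.j : ℕ) < t.k := t.hjk
      simp only [Finset.mem_filter, Finset.mem_univ, true_and] at ht
      simp only [Finset.mem_sigma, Finset.mem_Ico]
      omega
    · intro s hs t ht h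
      simp only [Finset.mem_filter, Finset.mem_univ, true_and] at hs ht
      simp only [Sigma.mk.injEq, heq_eq_eq] at h
      exact Triple.ext (Subtype.ext h.2) (Subtype.ext h.1) (Subtype.ext (hs.trans ht.symm))
    · rintro ⟨j, i⟩ h
      simp only [Finset.mem_sigma, Finset.mem_Ico] at h
      exact ⟨⟨⟨i, by constructor <;> omega⟩, ⟨j, by constructor <;> omega⟩,
        ⟨k, by constructor <;> omega⟩, h.2.2, h.1.2⟩, by simp, rfl⟩
  · rw [Finset.card_sigma, Finset.sum_Ico_eq_sum_range, Nat.choose_two_right,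
      ← Finset.sum_range_id]
    exact Finset.sum_congr rfl fun i _ => by rw [Nat.card_Ico]; omega

lemma sum_triple [Fintype (Triple n)] (f : ℕ → ℕ) :
    ∑ t : Triple n, f t.k = ∑ k ∈ Finset.Icc 3 n, (k - 1).choose 2 * f k := by
  rw [← Finset.sum_fiberwise_of_maps_to (t := Finset.Icc 3 n) (g := fun t : Triple n => (t.k : ℕ))]
  · refine Finset.sum_congr rfl fun k hk => ?_
    rw [← card_triple_k_eq (Finset.mem_Icc.1 hk).2, ← smul_eq_mul]
    refine Finset.sum_eq_card_nsmul fun t ht => ?_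
    rw [(Finset.mem_filter.1 ht).2]
  · intro t _
    have h1 : 1 ≤ (t.i : ℕ) := t.i.2.1
    have h2 : (t.i : ℕ) < t.j := t.hij
    have h3 : (t.j : ℕ) < t.k := t.hjk
    exact Finset.mem_Icc.2 ⟨by omega, t.k.2.2⟩

end Diagonal

end

end MatchingField

theorem mainTheorem4 (K : Type u) [Field K] (n : ℕ) :
    MatchingField.HasLinearQuotientsWith (MatchingField.diagIdeal K n)
        (MatchingField.diagMonomial K n) ∧
    (∀ t : MatchingField.Triple n,
      MatchingField.linearQuotientSet (MatchingField.diagMonomial K n) t =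
          MatchingField.Var.x '' {a | a < t.i} ∪
          MatchingField.Var.y '' {b | t.i < b ∧ b < t.j} ∪
          MatchingField.Var.z '' {c | t.j < c ∧ c < t.k} ∧
      (MatchingField.linearQuotientSet (MatchingField.diagMonomial K n) t).ncard =
          (t.k : ℕ) - 3) ∧
    ∀ ℓ : ℕ, MatchingField.bettiNumber (MatchingField.diagIdeal K n) ℓ =
      ((∑ k ∈ Finset.Icc 3 n, (k - 1).choose 2 * (k - 3).choose ℓ : ℕ) : Cardinal.{u}) := by
  have hset : ∀ t, MatchingField.linearQuotientSet (MatchingField.diagMonomial K n) t =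
      MatchingField.diagVars t := fun t =>
    MatchingField.linearQuotientSet_eq (MatchingField.colonBefore_diagMonomial K t)
  refine ⟨MatchingField.hasLinearQuotientsWith_diagIdeal K n,
    fun t => ⟨hset t, by rw [hset, MatchingField.ncard_diagVars]⟩, fun ℓ => ?_⟩
  have := Fintype.ofFinite (MatchingField.Triple n)
  rw [MatchingField.bettiNumber_of_hasLinearQuotientsWith
    (MatchingField.hasLinearQuotientsWith_diagIdeal K n)
    (MatchingField.diagMonomial_isHomogeneous K) (fun t => Set.toFinite _)]
  simp only [hset, MatchingField.ncard_diagVars]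
  rw [MatchingField.sum_triple fun k => (k - 3).choose ℓ]
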